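/- Let $d\ge 1$, let $R_d=\mathbb{Z}[u_1^{\pm1},\dots,u_d^{\pm1}]$, write $u^{\mathbf n}=u_1^{n_1}\cdots u_d^{n_d}$ for $\mathbf n\in\mathbb{Z}^d$, and let $M$ be a countable $R_d$-module. Let $X_M=\widehat M$ be the compact abelian group dual to the discrete abelian group $M$, and let $\alpha_M$ be the $\mathbb{Z}^d$-action on $X_M$ by continuous automorphisms for which $\alpha_M(\mathbf n)$ is dual to multiplication by $u^{\mathbf n}$ on $M$, that is, $(\alpha_M(\mathbf n)x)(a)=x(u^{\mathbf n}a)$ for $x\in X_M$, $a\in M$. Call a closed subgroup $H\subset X_M$ *$\alpha_M$-shrinking* if there is an $\mathbf n_H\in\mathbb{Z}^d$ such that $$\alpha_M(\mathbf n_H)(H)\subset H,\qquad \bigcap_{j\ge1}\alpha_M(j\mathbf n_H)(H)=\{0\},$$ and $\alpha_M(\mathbf n)(H)=H$ for every $\mathbf n\in\mathbb{Z}^d$ with $\langle\mathbf n,\mathbf n_H\rangle=0$, where $\langle\cdot,\cdot\rangle$ is the standard inner product. Let $X_M^s$ be the smallest closed subgroup of $X_M$ that contains all $\alpha_M$-shrinking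 subgroups. Let $F(M)$ be the submodule of all $m\in M$ such that $R_d\cdot m$ is finitely generated as an additive group, and for a submodule $N\subset M$ let $N^\perp=\{x\in X_M : x(a)=1\text{ for all }a\in N\}$. Then $X_M^s=F(M)^\perp$. -/

import Mathlib

/-- The ring `R_d = ℤ[u₁^{±1}, …, u_d^{±1}]` of Laurent polynomials with integral coefficients in
`d` commuting variables, i.e. the group ring of `ℤ^d`. -/
abbrev LaurentRing (d : ℕ) : Type := AddMonoidAlgebra ℤ (Fin d → ℤ)

/-- The monomial `u^n = u₁^{n₁} ⋯ u_d^{n_d}`. -/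
noncomputable def monom {d : ℕ} (n : Fin d → ℤ) : LaurentRing d := AddMonoidAlgebra.single n 1

theorem monom_zero {d : ℕ} : monom (0 : Fin d → ℤ) = 1 := rfl

theorem monom_add {d : ℕ} (m n : Fin d → ℤ) : monom (m + n) = monom m * monom n := by
  simp [monom, AddMonoidAlgebra.single_mul_single]

/-- The compact abelian group `X_M`: the Pontryagin dual of the discrete abelian group `M`, with
its compact-open topology. It is written multiplicatively: its neutral element is `1` and its
trivial subgroup is `⊥`. -/
abbrev DualGroup (M : Type*) [AddCommGroup M] [TopologicalSpace M] : Type _ :=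
  PontryaginDual (Multiplicative M)

section Action

variable {d : ℕ} (M : Type*) [AddCommGroup M] [Module (LaurentRing d) M]
  [TopologicalSpace M] [DiscreteTopology M]

/-- Multiplication by `u^n` on the discrete group `M`. -/
noncomputable def mulMonom (n : Fin d → ℤ) : Multiplicative M →ₜ* Multiplicative M where
  toMonoidHom := AddMonoidHom.toMultiplicative (DistribSMul.toAddMonoidHom M (monom n))
  continuous_toFun := continuous_of_discreteTopology (α := M) (β := M)

/-- The algebraic `ℤ^d`-action `α_M` on `X_M`: `α_M(n)` is the dual of multiplication by `u^n`. -/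
noncomputable def dualAction (n : Fin d → ℤ) : DualGroup M →ₜ* DualGroup M :=
  PontryaginDual.map (mulMonom M n)

theorem dualAction_apply (n : Fin d → ℤ) (x : DualGroup M) (a : M) :
    dualAction M n x (Multiplicative.ofAdd a) = x (Multiplicative.ofAdd (monom n • a)) := rfl

theorem dualAction_zero (x : DualGroup M) : dualAction M (0 : Fin d → ℤ) x = x := by
  refine PontryaginDual.ext fun a => ?_
  change x (Multiplicative.ofAdd (monom (0 : Fin d → ℤ) • Multiplicative.toAdd a)) = x a
  rw [monom_zero, one_smul]
  rfl

theorem dualAction_add (m n : Fin d → ℤ) (x : DualGroup M) :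
    dualAction M (m + n) x = dualAction M m (dualAction M n x) := by
  refine PontryaginDual.ext fun a => ?_
  change x (Multiplicative.ofAdd (monom (m + n) • Multiplicative.toAdd a)) =
    x (Multiplicative.ofAdd (monom n • (monom m • Multiplicative.toAdd a)))
  rw [smul_smul, ← monom_add, add_comm]

/-- `α_M(n)(H)`, the image of a subgroup `H` under `α_M(n)`. -/
noncomputable def imageSubgroup (n : Fin d → ℤ) (H : Subgroup (DualGroup M)) :
    Subgroup (DualGroup M) :=
  H.map (dualAction M n : DualGroup M →* DualGroup M)

/-- A closed subgroup `H` of `X_M` is `α_M`-shrinking if for some `n_H ∈ ℤ^d` the subgroups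
`α_M(j n_H)(H)` decrease to the trivial subgroup, and `α_M(n)(H) = H` for all `n ∈ ℤ^d` that are
orthogonal to `n_H`. -/
def IsShrinking (d : ℕ) (M : Type*) [AddCommGroup M] [Module (LaurentRing d) M]
    [TopologicalSpace M] [DiscreteTopology M] (H : Subgroup (DualGroup M)) : Prop :=
  IsClosed (H : Set (DualGroup M)) ∧
  ∃ nH : Fin d → ℤ,
    imageSubgroup M nH H ≤ H ∧
    (⨅ (j : ℕ) (_ : 1 ≤ j), imageSubgroup M (j • nH) H) = ⊥ ∧
    ∀ n : Fin d → ℤ, n ⬝ᵥ nH = 0 → imageSubgroup M n H = H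

/-- `X_M^s`: the smallest closed subgroup of `X_M` that contains all `α_M`-shrinking subgroups. -/
noncomputable def shrinkingHull (d : ℕ) (M : Type*) [AddCommGroup M] [Module (LaurentRing d) M]
    [TopologicalSpace M] [DiscreteTopology M] : Subgroup (DualGroup M) :=
  sInf {K : Subgroup (DualGroup M) |
    IsClosed (K : Set (DualGroup M)) ∧ ∀ H, IsShrinking d M H → H ≤ K}

theorem shrinkingHull_isLeast (d : ℕ) (M : Type*) [AddCommGroup M] [Module (LaurentRing d) M]
    [TopologicalSpace M] [DiscreteTopology M] :
    IsLeast {K : Subgroup (DualGroup M) |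
      IsClosed (K : Set (DualGroup M)) ∧ ∀ H, IsShrinking d M H → H ≤ K}
      (shrinkingHull d M) := by
  refine ⟨⟨?_, fun H hH => le_sInf fun K hK => hK.2 H hH⟩, fun K hK => sInf_le hK⟩
  rw [shrinkingHull, Subgroup.coe_sInf]
  exact isClosed_biInter fun K hK => hK.1

end Action

theorem span_fg_iff {d : ℕ} {M : Type*} [AddCommGroup M] [Module (LaurentRing d) M] (m : M) :
    (Submodule.span (LaurentRing d) {m}).toAddSubgroup.FG ↔
      ((Submodule.span (LaurentRing d) {m}).restrictScalars ℤ).FG :=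
  (Submodule.fg_iff_addSubgroup_fg
    ((Submodule.span (LaurentRing d) {m}).restrictScalars ℤ)).symm

/-- `F(M)`: the submodule of all `m ∈ M` such that `R_d · m` is finitely generated as an additive
group. -/
def finPart (d : ℕ) (M : Type*) [AddCommGroup M] [Module (LaurentRing d) M] :
    Submodule (LaurentRing d) M where
  carrier := {m | (Submodule.span (LaurentRing d) {m}).toAddSubgroup.FG}
  zero_mem' := by
    have h : (Submodule.span (LaurentRing d) {(0 : M)}).toAddSubgroup = ⊥ := by
      rw [Submodule.span_zero_singleton]; rfl
    change (Submodule.span (LaurentRing d) {(0 : M)}).toAddSubgroup.FG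
    rw [h]
    exact ⟨∅, by simp⟩
  add_mem' := by
    intro a b ha hb
    change (Submodule.span (LaurentRing d) {a + b}).toAddSubgroup.FG
    replace ha := (span_fg_iff a).1 ha
    replace hb := (span_fg_iff b).1 hb
    rw [span_fg_iff]
    have hle : (Submodule.span (LaurentRing d) {a + b}).restrictScalars ℤ ≤
        (Submodule.span (LaurentRing d) {a}).restrictScalars ℤ ⊔
          (Submodule.span (LaurentRing d) {b}).restrictScalars ℤ := by
      rintro x hx
      obtain ⟨r, rfl⟩ := Submodule.mem_span_singleton.1 hx
      rw [smul_add]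
      exact Submodule.add_mem_sup
        (Submodule.mem_span_singleton.2 ⟨r, rfl⟩) (Submodule.mem_span_singleton.2 ⟨r, rfl⟩)
    have : IsNoetherian ℤ ↥((Submodule.span (LaurentRing d) {a}).restrictScalars ℤ ⊔
          (Submodule.span (LaurentRing d) {b}).restrictScalars ℤ) :=
      isNoetherian_of_fg_of_noetherian _ (ha.sup hb)
    exact Submodule.FG.of_le (ha.sup hb) hle
  smul_mem' := by
    intro r a ha
    change (Submodule.span (LaurentRing d) {r • a}).toAddSubgroup.FG
    replace ha := (span_fg_iff a).1 ha
    rw [span_fg_iff]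
    exact Submodule.FG.of_le ha fun x hx => Submodule.span_singleton_smul_le (LaurentRing d) r a hx

/-- `N^⊥`: the subgroup of all `x ∈ X_M` with `x(a) = 1` for all `a ∈ N`. -/
def perp {d : ℕ} {M : Type*} [AddCommGroup M] [Module (LaurentRing d) M] [TopologicalSpace M]
    (N : Submodule (LaurentRing d) M) : Subgroup (DualGroup M) where
  carrier := {x | ∀ a ∈ N, x (Multiplicative.ofAdd a) = 1}
  one_mem' := fun _ _ => rfl
  mul_mem' := by
    intro x y hx hy a ha
    change x (Multiplicative.ofAdd a) * y (Multiplicative.ofAdd a) = 1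
    rw [hx a ha, hy a ha, one_mul]
  inv_mem' := by
    intro x hx a ha
    change (x (Multiplicative.ofAdd a))⁻¹ = 1
    rw [hx a ha, inv_one]

/-!
Pontryagin duality turns the claim into one about subgroups `N` of the discrete module `M`. The
annihilator of `N` is shrinking with direction `v` as soon as `u^v N ⊆ N`, `u^n N ⊆ N` for `n`
orthogonal to `v`, and `M` is the union of the `u^{-kv} N` (`isShrinking_dualAnnihilator`).

A shrinking group is contained in `F(M)^⊥` because the circle has no small subgroups
(`IsShrinking.le_perp_finPart`). For the other inclusion, a point of `F(M)^⊥` outside of the closed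
subgroup `X_M^s` would be detected by some `m ∈ M` on which `X_M^s` is trivial
(`exists_character_separating_closed_subgroup`). Then `m ∉ F(M)`, and it is enough to find a
subgroup `N` as above that does not contain `m`, since some character is trivial on `N` but not at
`m` (`exists_dual_eq_one_on_apply_ne_one`).

Such an `N` is found in two steps. Let `S` be the ring generated by `u^v` and the `u^n` with `n`
orthogonal to `v`; it is Noetherian. If `m ∉ u^v S m`, an `S`-submodule that is maximal among those
containing `u^v m` but not `m` has the required properties
(`exists_submodule_not_mem_torsion_quotient`). The direction `v` comes from a valuation. As `R_d m`
is not finitely generated as a group, some `u_i^{±1}` is not integral over `ℤ` in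
`R_d / Ann(m)`, nor in a suitable field `K` to which this ring maps
(`exists_ringHom_field_not_isIntegral`). On `K` there is then a valuation whose values at the
monomials are governed by an integral vector `v ≠ 0` (`exists_integral_direction`). Its value is at
most `1` on `S` and less than `1` at `u^v`, which excludes a relation `m = u^v s m` with `s ∈ S`.

It matters here that `v` is integral, that is, that the values of all `u_j` are commensurable. To
ensure this, the valuation is taken to dominate a one-dimensional Noetherian local domain, in which
incommensurable values would make lengths grow quadratically instead of linearly
(`exists_ne_valuation_monomial_eq`).
-/

/-! ### Duality between `M` and `X_M` -/

theorem continuous_dual_eval {M : Type*} [AddCommGroup M] [TopologicalSpace M]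
    [DiscreteTopology M] (a : Multiplicative M) : Continuous fun x : DualGroup M => x a :=
  continuous_eval_const (F := Multiplicative M →ₜ* Circle) a

open MeasureTheory in
/-- The half of Pontryagin duality for closed subgroups of the compact group `X_M` that is needed
here: a point outside a closed subgroup `K` is detected by an element of `M` on which `K` is
trivial. Averaging over `K` and averaging over the coset `xK` are continuous functionals on
`C(X_M, ℂ)`. If no such element existed they would agree on all evaluations at elements of `M`,
hence everywhere by the Stone–Weierstrass theorem, although `K` and `xK` are disjoint closed
sets. -/
theorem exists_character_separating_closed_subgroup {M : Type*} [AddCommGroup M]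
    [TopologicalSpace M] [DiscreteTopology M] {K : Subgroup (DualGroup M)}
    (hK : IsClosed (K : Set (DualGroup M))) {x : DualGroup M} (hx : x ∉ K) :
    ∃ a : M, (∀ k ∈ K, k (Multiplicative.ofAdd a) = 1) ∧ x (Multiplicative.ofAdd a) ≠ 1 := by
  have : DiscreteTopology (Multiplicative M) := inferInstanceAs (DiscreteTopology M)
  by_contra! hcon
  have : CompactSpace K := isCompact_iff_compactSpace.1 hK.isCompact
  let : MeasurableSpace K := borel K
  have : BorelSpace K := ⟨rfl⟩
  let μ : Measure K := Measure.haarMeasure ⊤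
  have : IsProbabilityMeasure μ := ⟨by
    simpa using Measure.haarMeasure_self (K₀ := (⊤ : TopologicalSpace.PositiveCompacts K))⟩
  let ev : Multiplicative M → C(DualGroup M, ℂ) := fun a =>
    ⟨fun y => ((y a : Circle) : ℂ), continuous_subtype_val.comp (continuous_dual_eval a)⟩
  have hint : ∀ f : C(DualGroup M, ℂ), ∀ y : DualGroup M,
      Integrable (fun k : K => f (y * k)) μ := by
    intro f y
    have hc := f.continuous.comp (continuous_const.mul continuous_subtype_val : Continuous
      fun k : K => y * k)
    exact hc.integrable_of_hasCompactSupport (HasCompactSupport.of_compactSpace _)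
  -- the difference between averaging over `K` and averaging over `xK`
  let Φ : C(DualGroup M, ℂ) → ℂ := fun f => (∫ k : K, f (1 * k) ∂μ) - ∫ k : K, f (x * k) ∂μ
  let L : C(DualGroup M, ℂ) →ₗ[ℂ] ℂ :=
    { toFun := Φ
      map_add' := by
        intro f g
        simp only [Φ, ContinuousMap.add_apply]
        rw [integral_add (hint f 1) (hint g 1), integral_add (hint f x) (hint g x)]
        ring
      map_smul' := by
        intro c f
        simp only [Φ, ContinuousMap.smul_apply, integral_smul, RingHom.id_apply, smul_sub] }
  have hLcont : Continuous L := by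
    refine AddMonoidHomClass.continuous_of_bound L 2 fun f => ?_
    have hb : ∀ y : DualGroup M, ‖∫ k : K, f (y * k) ∂μ‖ ≤ ‖f‖ := by
      intro y
      refine (norm_integral_le_of_norm_le_const (C := ‖f‖)
        (Filter.Eventually.of_forall fun k => f.norm_coe_le_norm _)).trans ?_
      simp
    calc ‖Φ f‖ ≤ ‖f‖ + ‖f‖ := (norm_sub_le _ _).trans (add_le_add (hb 1) (hb x))
      _ = 2 * ‖f‖ := by ring
  have hLev : ∀ a, L (ev a) = 0 := by
    intro a
    change (∫ k : K, (((1 * (k : DualGroup M)) a : Circle) : ℂ) ∂μ) -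
      ∫ k : K, (((x * (k : DualGroup M)) a : Circle) : ℂ) ∂μ = 0
    have hmul : ∀ y : DualGroup M, ∫ k : K, (((y * (k : DualGroup M)) a : Circle) : ℂ) ∂μ =
        (y a : ℂ) * ∫ k : K, (((k : DualGroup M) a : Circle) : ℂ) ∂μ := by
      intro y
      rw [← integral_const_mul]
      rfl
    rw [hmul, hmul]
    by_cases h : ∀ k ∈ K, k a = 1
    · have := hcon (Multiplicative.toAdd a) h
      change x a = 1 at this
      rw [this]
      simp
    · push Not at h
      obtain ⟨k₀, hk₀, hne⟩ := h
      -- translating by `k₀` multiplies the average by `k₀ a ≠ 1`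
      have hinv : ∫ k : K, (((k : DualGroup M) a : Circle) : ℂ) ∂μ =
          (k₀ a : ℂ) * ∫ k : K, (((k : DualGroup M) a : Circle) : ℂ) ∂μ := by
        rw [← hmul k₀]
        exact (integral_mul_left_eq_self (μ := μ)
          (fun k : K => (((k : DualGroup M) a : Circle) : ℂ)) ⟨k₀, hk₀⟩).symm
      have h0 : ∫ k : K, (((k : DualGroup M) a : Circle) : ℂ) ∂μ = 0 := by
        have h1 : ((k₀ a : ℂ) - 1) * ∫ k : K, (((k : DualGroup M) a : Circle) : ℂ) ∂μ = 0 := by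
          rw [sub_mul, ← hinv, one_mul, sub_self]
        refine (mul_eq_zero.1 h1).resolve_left fun h2 => hne ?_
        exact Circle.ext (by simpa using sub_eq_zero.1 h2)
      rw [h0]; simp
  have hclosure : (Submonoid.closure (Set.range ev ∪ star (Set.range ev)) :
      Set C(DualGroup M, ℂ)) ⊆ Set.range ev := by
    intro f hf
    refine Submonoid.closure_induction (motive := fun f _ => f ∈ Set.range ev) ?_ ?_ ?_ hf
    · rintro f (h | h)
      · exact h
      · obtain ⟨a, ha⟩ := h
        refine ⟨a⁻¹, ?_⟩
        rw [← star_star f, ← ha]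
        ext y
        change ((y a⁻¹ : Circle) : ℂ) = star ((y a : Circle) : ℂ)
        rw [map_inv, Circle.coe_inv_eq_conj]
        rfl
    · refine ⟨1, ?_⟩
      ext y
      change ((y 1 : Circle) : ℂ) = 1
      rw [map_one, Circle.coe_one]
    · rintro _ _ _ _ ⟨a, rfl⟩ ⟨b, rfl⟩
      refine ⟨a * b, ?_⟩
      ext y
      change ((y (a * b) : Circle) : ℂ) = (y a : ℂ) * (y b : ℂ)
      rw [map_mul, Circle.coe_mul]
  let A : StarSubalgebra ℂ C(DualGroup M, ℂ) := StarAlgebra.adjoin ℂ (Set.range ev)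
  have hA : A.topologicalClosure = ⊤ := by
    refine ContinuousMap.starSubalgebra_topologicalClosure_eq_top_of_separatesPoints A ?_
    intro y z hyz
    have : ∃ a, y a ≠ z a := by
      by_contra! h
      exact hyz (PontryaginDual.ext h)
    obtain ⟨a, ha⟩ := this
    exact ⟨_, ⟨ev a, StarAlgebra.subset_adjoin ℂ _ ⟨a, rfl⟩, rfl⟩, fun h => ha (Circle.ext h)⟩
  have hLA : ∀ f ∈ A, L f = 0 := by
    intro f hf
    have hf' : f ∈ Submodule.span ℂ (Set.range ev) := by
      have h1 : f ∈ Algebra.adjoin ℂ (Set.range ev ∪ star (Set.range ev)) := hf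
      rw [← Subalgebra.mem_toSubmodule, Algebra.adjoin_eq_span] at h1
      exact Submodule.span_mono hclosure h1
    have : Submodule.span ℂ (Set.range ev) ≤ LinearMap.ker L := by
      rw [Submodule.span_le]
      rintro _ ⟨a, rfl⟩
      exact hLev a
    exact this hf'
  have hL0 : ∀ f, L f = 0 := by
    intro f
    have hf : f ∈ closure (A : Set C(DualGroup M, ℂ)) := by
      have : f ∈ A.topologicalClosure := hA ▸ StarSubalgebra.mem_top
      exact this
    exact closure_minimal (t := {f | L f = 0}) hLA (isClosed_eq hLcont continuous_const) hf
  -- a continuous function that is `0` on `K` and `1` on `xK`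
  have hdisj : Disjoint (K : Set (DualGroup M)) ((x * ·) '' (K : Set (DualGroup M))) := by
    rw [Set.disjoint_left]
    rintro _ hk ⟨k', hk', rfl⟩
    exact hx ((K.mul_mem_cancel_right hk').1 hk)
  obtain ⟨f, hf0, hf1, -⟩ := exists_continuous_zero_one_of_isClosed hK
    ((Homeomorph.mulLeft x).isClosedMap _ hK) hdisj
  have h := hL0 ((⟨Complex.ofReal, Complex.continuous_ofReal⟩ : C(ℝ, ℂ)).comp f)
  change (∫ k : K, ((f (1 * k) : ℝ) : ℂ) ∂μ) - ∫ k : K, ((f (x * k) : ℝ) : ℂ) ∂μ = 0 at h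
  have e0 : ∀ k : K, f (k : DualGroup M) = 0 := fun k => hf0 k.2
  have e1 : ∀ k : K, f (x * (k : DualGroup M)) = 1 := fun k => hf1 ⟨k, k.2, rfl⟩
  simp [e0, e1] at h

theorem exists_circle_hom_apply_ne_one {A : Type*} [AddCommGroup A] {a : A} (ha : a ≠ 0) :
    ∃ χ : Multiplicative A →* Circle, χ (Multiplicative.ofAdd a) ≠ 1 := by
  obtain ⟨c, hc⟩ := CharacterModule.exists_character_apply_ne_zero_of_ne_zero ha
  -- rational characters become circle characters through the embedding `ℚ/ℤ → ℝ/ℤ`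
  let g : ℚ →+ AddCircle (1 : ℝ) :=
    (QuotientAddGroup.mk' (AddSubgroup.zmultiples (1 : ℝ))).comp (Rat.castHom ℝ).toAddMonoidHom
  have hker : g.ker = AddSubgroup.zmultiples (1 : ℚ) := by
    ext q
    rw [AddMonoidHom.mem_ker, AddSubgroup.mem_zmultiples_iff]
    change ((q : ℝ) : AddCircle (1 : ℝ)) = 0 ↔ _
    rw [AddCircle.coe_eq_zero_iff]
    refine exists_congr fun n => ?_
    simp only [zsmul_eq_mul, mul_one]
    norm_cast
  let h : AddCircle (1 : ℚ) →+ AddCircle (1 : ℝ) :=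
    QuotientAddGroup.lift (AddSubgroup.zmultiples (1 : ℚ)) g hker.ge
  have hh : Function.Injective h := by
    rw [injective_iff_map_eq_zero]
    intro q
    induction q using QuotientAddGroup.induction_on with
    | H q =>
      intro hq
      have : q ∈ g.ker := hq
      rw [hker] at this
      exact (QuotientAddGroup.eq_zero_iff q).2 this
  refine ⟨
    { toFun := fun b => AddCircle.toCircle (h (c (Multiplicative.toAdd b)))
      map_one' := by simp
      map_mul' := fun x y => by simp [AddCircle.toCircle_add] }, ?_⟩
  intro h1
  have h2 : AddCircle.toCircle (h (c a)) = AddCircle.toCircle (0 : AddCircle (1 : ℝ)) := by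
    rw [AddCircle.toCircle_zero]; exact h1
  have h3 := AddCircle.injective_toCircle one_ne_zero h2
  exact hc (hh (by rw [h3, map_zero]))

/-- The other half of the duality: a subgroup `N` of the discrete group `M` is the intersection
of the kernels of the characters that are trivial on it. -/
theorem exists_dual_eq_one_on_apply_ne_one {M : Type*} [AddCommGroup M]
    [TopologicalSpace M] [DiscreteTopology M] {N : AddSubgroup M} {a : M} (ha : a ∉ N) :
    ∃ x : DualGroup M, (∀ b ∈ N, x (Multiplicative.ofAdd b) = 1) ∧
      x (Multiplicative.ofAdd a) ≠ 1 := by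
  obtain ⟨χ, hχ⟩ := exists_circle_hom_apply_ne_one (a := (a : M ⧸ N))
    (fun h => ha ((QuotientAddGroup.eq_zero_iff a).1 h))
  let ψ : Multiplicative M →* Circle :=
    χ.comp (AddMonoidHom.toMultiplicative (QuotientAddGroup.mk' N))
  refine ⟨(⟨ψ, continuous_of_discreteTopology (α := M) (β := Circle)⟩ :
    Multiplicative M →ₜ* Circle), fun b hb => ?_, hχ⟩
  change χ (Multiplicative.ofAdd (b : M ⧸ N)) = 1
  rw [(QuotientAddGroup.eq_zero_iff b).2 hb]
  exact map_one χ

/-! ### Valuations with commensurable values -/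

/-- In a Noetherian domain of dimension one, a valuation with values at most `1` cannot separate
all monomials in `x` and `z` if `x` divides a power of `z`. Otherwise the values of the monomials
of degree less than `n` in each variable would give a chain of `n ^ 2` distinct ideals above
`z ^ ((k + 1) * n)`, while the length of `B ⧸ (z ^ ((k + 1) * n))` is linear in `n`. -/
theorem exists_ne_valuation_monomial_eq {B Γ : Type*} [CommRing B] [IsDomain B]
    [IsNoetherianRing B] [Ring.KrullDimLE 1 B] [LinearOrderedCommGroupWithZero Γ]
    (ν : Valuation B Γ) (hν : ∀ b, ν b ≤ 1) {x z : B} (hz : z ≠ 0) {k : ℕ} (hk : x ∣ z ^ k) :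
    ∃ p q : ℕ × ℕ, p ≠ q ∧ ν (x ^ p.1 * z ^ p.2) = ν (x ^ q.1 * z ^ q.2) := by
  by_contra! hcon
  let g : ℕ × ℕ → Γ := fun p => ν (x ^ p.1 * z ^ p.2)
  have hg : Function.Injective g := fun p q h => by
    by_contra hne
    exact hcon p q hne h
  obtain ⟨l, hl⟩ := ENat.ne_top_iff_exists.1
    (Ring.ord_ne_top (mem_nonZeroDivisors_of_ne_zero hz))
  -- with this `n` the length `(k + 1) * n * l = n * (n - 2)` is less than `n * n - 1`
  obtain ⟨n, hn⟩ : ∃ n, n = (k + 1) * l + 2 := ⟨_, rfl⟩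
  let N := (k + 1) * n
  let S : Finset Γ := (Finset.range n ×ˢ Finset.range n).image g
  have hS : S.card = n * n := by
    rw [Finset.card_image_of_injective _ hg, Finset.card_product, Finset.card_range]
  have hmono : ∀ b c, b ∣ c → ν c ≤ ν b := by
    rintro b _ ⟨c, rfl⟩
    rw [map_mul]
    exact mul_le_of_le_one_right' (hν c)
  have hSN : ∀ γ ∈ S, ν (z ^ N) ≤ γ := by
    intro γ hγ
    obtain ⟨⟨i, j⟩, hij, rfl⟩ := Finset.mem_image.1 hγ
    rw [Finset.mem_product, Finset.mem_range, Finset.mem_range] at hij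
    refine hmono _ _ ?_
    refine (mul_dvd_mul (pow_dvd_pow_of_dvd hk i) dvd_rfl).trans ?_
    rw [← pow_mul, ← pow_add]
    refine pow_dvd_pow z ?_
    change k * i + j ≤ (k + 1) * n
    have := Nat.mul_le_mul_left k hij.1.le
    have := hij.2
    rw [Nat.add_mul]
    simp only at *
    omega
  -- the ideals `{b | ν b ≤ γ}` for `γ ∈ S` form a chain above `z ^ N`
  let J : Γ → Ideal B := fun γ =>
    { carrier := {b | ν b ≤ γ}
      add_mem' := fun ha hb => (ν.map_add_le ha hb)
      zero_mem' := by simp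
      smul_mem' := fun c b hb => by
        change ν (c * b) ≤ γ
        rw [map_mul]
        exact (mul_le_of_le_one_left' (hν c)).trans hb }
  let I : Ideal B := Ideal.span {z ^ N}
  have hIJ : ∀ γ ∈ S, I ≤ J γ := fun γ hγ =>
    (Ideal.span_singleton_le_iff_mem _).2 (hSN γ hγ)
  let e := S.orderEmbOfFin hS
  have heS : ∀ i, e i ∈ S := fun i => Finset.orderEmbOfFin_mem S hS i
  have hstrict : StrictMono fun i => Submodule.map I.mkQ (J (e i)) := by
    refine Monotone.strictMono_of_injective ?_ ?_
    · intro i j hij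
      exact Submodule.map_mono fun b (hb : ν b ≤ e i) => hb.trans (e.monotone hij)
    · intro i j hij
      have hJ : J (e i) = J (e j) := by
        have := congrArg (Submodule.comap I.mkQ) hij
        simpa [Submodule.comap_map_mkQ, hIJ _ (heS _)] using this
      have key : ∀ i j, J (e i) = J (e j) → e i ≤ e j := by
        intro i j h
        obtain ⟨p, -, hp⟩ := Finset.mem_image.1 (heS i)
        have : x ^ p.1 * z ^ p.2 ∈ J (e i) := hp.le
        rw [h] at this
        rw [← hp]
        exact this
      exact e.injective (le_antisymm (key i j hJ) (key j i hJ.symm))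
  have hnpos : n * n - 1 + 1 = n * n := by
    have : 0 < n * n := by subst hn; positivity
    omega
  let s : LTSeries (Submodule B (B ⧸ I)) := LTSeries.mk (n * n - 1)
    (fun i => Submodule.map I.mkQ (J (e (Fin.cast hnpos i))))
    (hstrict.comp fun i j hij => by simpa using hij)
  have h1 : ((n * n - 1 : ℕ) : WithBot ℕ∞) ≤ Module.length B (B ⧸ I) := by
    rw [Module.coe_length]
    exact (le_iSup (fun p : LTSeries (Submodule B (B ⧸ I)) => (p.length : WithBot ℕ∞)) s)
  have h2 : Module.length B (B ⧸ I) = N • Ring.ord B z :=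
    Ring.ord_pow (mem_nonZeroDivisors_of_ne_zero hz) N
  rw [h2, ← hl] at h1
  have h3 : n * n - 1 ≤ N * l := by
    rw [nsmul_eq_mul] at h1
    have h1' : ((n * n - 1 : ℕ) : WithBot ℕ∞) ≤ ((N * l : ℕ) : WithBot ℕ∞) := by
      push_cast at h1 ⊢
      exact h1
    exact_mod_cast h1'
  have h4 : N * l = n * ((k + 1) * l) := by simp only [N]; ring
  have h5 : (k + 1) * l = n - 2 := by omega
  rw [h4, h5, Nat.mul_sub] at h3
  have h6 : 2 ≤ n := by omega
  have := Nat.mul_le_mul_left n h6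
  omega

/-- If `z` is a nonzero nonunit of a Noetherian domain `C`, then some valuation on a field
containing `C` is less than `1` at `z` and takes on `C` only values commensurable with its value at
`z`. Localizing at a minimal prime over `z` gives a one-dimensional local domain by Krull's
principal ideal theorem, and any valuation ring that dominates it will do. -/
theorem exists_valuationSubring_commensurable {K C : Type*} [Field K] [CommRing C] [IsDomain C]
    [IsNoetherianRing C] (f : C →+* K) (hf : Function.Injective f) {z : C} (hz0 : z ≠ 0)
    (hz : ¬ IsUnit z) :
    ∃ V : ValuationSubring K, V.valuation (f z) < 1 ∧
      ∀ c, c ≠ 0 → ∃ a : ℕ, 0 < a ∧ ∃ b : ℤ,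
        V.valuation (f c) ^ a = V.valuation (f z) ^ b := by
  have hne : Ideal.span {z} ≠ ⊤ := fun h => hz (Ideal.span_singleton_eq_top.1 h)
  obtain ⟨Q, hQ⟩ := (Ideal.nonempty_minimalPrimes (I := Ideal.span {z}) hne)
  have hQp : Q.IsPrime := hQ.isPrime
  let B := Localization.AtPrime Q
  have hdim : Ring.KrullDimLE 1 B := by
    rw [Ring.KrullDimLE, Order.krullDimLE_iff]
    change ringKrullDim B ≤ _
    rw [IsLocalization.AtPrime.ringKrullDim_eq_height Q B]
    exact_mod_cast Ideal.height_le_one_of_isPrincipal_of_mem_minimalPrimes _ Q hQ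
  have hBdom : IsDomain B := inferInstance
  have hBnoeth : IsNoetherianRing B := IsLocalization.isNoetherianRing Q.primeCompl B inferInstance
  have hunit : ∀ y : Q.primeCompl, IsUnit (f y) := by
    intro y
    refine IsUnit.mk0 _ fun h => y.2 ?_
    rw [(injective_iff_map_eq_zero f).1 hf _ h]
    exact Q.zero_mem
  let g : B →+* K := IsLocalization.lift hunit
  have hg : ∀ c, g (algebraMap C B c) = f c := fun c => IsLocalization.lift_eq hunit c
  obtain ⟨V, hV, hloc⟩ := IsLocalRing.exists_factor_valuationRing g
  let ν := V.valuation.comap g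
  have hν : ∀ b, ν b ≤ 1 := fun b => (V.valuation_le_one_iff _).2 (hV b)
  have hνlt : ∀ b, ¬ IsUnit b → ν b < 1 := by
    intro b hb
    have : ¬ IsUnit (⟨g b, hV b⟩ : V) := fun h => hb (hloc.map_nonunit b h)
    rw [V.valuation_eq_one_iff] at this
    exact lt_of_le_of_ne (hν b) this
  have hzQ : z ∈ Q := hQ.1.2 (Ideal.mem_span_singleton_self z)
  have hzm : algebraMap C B z ∈ IsLocalRing.maximalIdeal B :=
    (IsLocalization.AtPrime.to_map_mem_maximal_iff B Q z).2 hzQ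
  have hz1 : ν (algebraMap C B z) < 1 := hνlt _ hzm
  have halg : Function.Injective (algebraMap C B) :=
    IsLocalization.injective B Q.primeCompl_le_nonZeroDivisors
  have hne0 : ∀ c, c ≠ 0 → algebraMap C B c ≠ 0 := fun c hc h =>
    hc ((injective_iff_map_eq_zero _).1 halg c h)
  have hνz : ν (algebraMap C B z) = V.valuation (f z) := congrArg _ (hg z)
  have hfz : V.valuation (f z) ≠ 0 := by
    rw [Ne, map_eq_zero]
    exact fun h => hz0 ((injective_iff_map_eq_zero f).1 hf _ h)
  rw [hνz] at hz1
  refine ⟨V, hz1, fun c hc => ?_⟩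
  -- the maximal ideal is the only nonzero prime, so `z` lies in every prime containing `c`
  have hrad : algebraMap C B z ∈ (Ideal.span {algebraMap C B c}).radical := by
    rw [Ideal.radical_eq_sInf, Submodule.mem_sInf]
    rintro P ⟨hP, hPp⟩
    have hP0 : P ≠ ⊥ := by
      rintro rfl
      exact hne0 c hc (by simpa using hP)
    rw [IsLocalRing.eq_maximalIdeal (hPp.isMaximal_of_ne_bot hP0)]
    exact hzm
  obtain ⟨k, hk⟩ := hrad
  rw [Ideal.mem_span_singleton] at hk
  obtain ⟨p, q, hpq, h⟩ := exists_ne_valuation_monomial_eq ν hν (hne0 z hz0) hk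
  simp only [map_mul, map_pow, hνz] at h
  have hνc : ν (algebraMap C B c) = V.valuation (f c) := congrArg _ (hg c)
  have hfc : V.valuation (f c) ≠ 0 := by
    rw [Ne, map_eq_zero]
    exact fun h => hc ((injective_iff_map_eq_zero f).1 hf _ h)
  rw [hνc] at h
  generalize V.valuation (f c) = X at *
  generalize V.valuation (f z) = Z at *
  have key : ∀ p q : ℕ × ℕ, q.1 < p.1 → X ^ p.1 * Z ^ p.2 = X ^ q.1 * Z ^ q.2 →
      ∃ a : ℕ, 0 < a ∧ ∃ b : ℤ, X ^ a = Z ^ b := by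
    intro p q hlt h
    refine ⟨p.1 - q.1, by omega, q.2 - p.2, ?_⟩
    rw [pow_sub₀ _ hfc hlt.le, zpow_sub₀ hfz, zpow_natCast, zpow_natCast, ← div_eq_mul_inv,
      div_eq_div_iff (pow_ne_zero _ hfc) (pow_ne_zero _ hfz), h, mul_comm]
  rcases lt_trichotomy p.1 q.1 with hlt | heq | hlt
  · exact key q p hlt h.symm
  · exfalso
    rw [heq] at h
    have h2 := mul_left_cancel₀ (pow_ne_zero _ hfc) h
    refine hpq (Prod.ext heq ?_)
    exact (pow_right_strictAnti₀ (zero_lt_iff.2 hfz) hz1).injective h2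
  · exact key p q hlt h

/-- Suppose that one of the `u j ^ (±1)` is not integral over `ℤ`. Then some valuation of the
field orders the monomials `u ^ n` by an integral direction: their value is `1` where `n ⬝ᵥ v`
vanishes and less than `1` where it is positive. -/
theorem exists_integral_direction {K : Type*} [Field K] {d : ℕ} (u : Fin d → K)
    (hu : ∀ j, u j ≠ 0) {i : Fin d} {y : K} (hy : y = u i ∨ y = (u i)⁻¹)
    (hint : ¬ IsIntegral ℤ y) :
    ∃ (V : ValuationSubring K) (v : Fin d → ℤ), v ≠ 0 ∧
      ∀ n : Fin d → ℤ, (n ⬝ᵥ v = 0 → V.valuation (∏ j, u j ^ n j) = 1) ∧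
        (0 < n ⬝ᵥ v → V.valuation (∏ j, u j ^ n j) < 1) := by
  have hy0 : y ≠ 0 := by rcases hy with rfl | rfl <;> simp [hu]
  -- the integral closure of `ℤ` is an intersection of valuation rings, one of which omits `y`
  obtain ⟨W, hW⟩ : ∃ W : ValuationSubring K, y ∉ W := by
    have hR : IsIntegrallyClosedIn (integralClosure ℤ K).toSubring K :=
      inferInstanceAs (IsIntegrallyClosedIn (integralClosure ℤ K) K)
    obtain ⟨W, -, hW⟩ := Subring.exists_le_valuationSubring_of_isIntegrallyClosedIn
      (R := (integralClosure ℤ K).toSubring) (x := y) hint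
    exact ⟨W, hW⟩
  classical
  -- replacing `u j` by its inverse where necessary, all generators lie in `W`, and then `y⁻¹` is a
  -- nonunit of the ring they generate
  let w : Fin d → K := fun j => if u j ∈ W then u j else (u j)⁻¹
  have hwW : ∀ j, w j ∈ W := by
    intro j
    by_cases h : u j ∈ W
    · simp [w, h]
    · simpa [w, h] using (W.mem_or_inv_mem (u j)).resolve_left h
  have hwu : ∀ j, u j = w j ∨ u j = (w j)⁻¹ := by
    intro j
    by_cases h : u j ∈ W <;> simp [w, h]
  have hwi : w i = y⁻¹ := by
    rcases hy with rfl | rfl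
    · simp [w, hW]
    · have : u i ∈ W := by simpa using (W.mem_or_inv_mem (u i)⁻¹).resolve_left hW
      simp [w, this]
  let C : Subalgebra ℤ K := Algebra.adjoin ℤ (Set.range w)
  have hCW : ∀ c ∈ C, c ∈ W := by
    intro c hc
    induction hc using Algebra.adjoin_induction with
    | mem x hx => obtain ⟨j, rfl⟩ := hx; exact hwW j
    | algebraMap r => exact (algebraMap_int_eq K ▸ intCast_mem W r)
    | add x y _ _ hx hy => exact W.add_mem _ _ hx hy
    | mul x y _ _ hx hy => exact W.mul_mem _ _ hx hy
  have hfg : IsNoetherianRing C :=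
    Algebra.FiniteType.isNoetherianRing ℤ (h := (Subalgebra.fg_iff_finiteType C).1
      (Subalgebra.fg_def.2 ⟨_, Set.finite_range w, rfl⟩))
  have hwC : ∀ j, w j ∈ C := fun j => Algebra.subset_adjoin ⟨j, rfl⟩
  have hw0 : ∀ j, w j ≠ 0 := by
    intro j
    by_cases h : u j ∈ W <;> simp [w, h, hu]
  let z : C := ⟨w i, hwC i⟩
  have hz0 : z ≠ 0 := fun h => hw0 i (congrArg Subtype.val h)
  have hz : ¬ IsUnit z := by
    intro h
    obtain ⟨c, hc⟩ := isUnit_iff_exists_inv.1 h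
    have h1 : w i * (c : K) = 1 := congrArg Subtype.val hc
    rw [hwi, inv_mul_eq_one₀ hy0] at h1
    exact hW (h1 ▸ hCW c c.2)
  obtain ⟨V, hVz, hV⟩ := exists_valuationSubring_commensurable C.val.toRingHom
    Subtype.val_injective hz0 hz
  change V.valuation (w i) < 1 at hVz
  have hVu : ∀ j, ∃ a : ℕ, 0 < a ∧ ∃ b : ℤ,
      V.valuation (u j) ^ a = V.valuation (w i) ^ b := by
    intro j
    obtain ⟨a, ha, b, hab⟩ := hV ⟨w j, hwC j⟩ (fun h => hw0 j (congrArg Subtype.val h))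
    change V.valuation (w j) ^ a = V.valuation (w i) ^ b at hab
    rcases hwu j with h | h
    · exact ⟨a, ha, b, by rw [h, hab]⟩
    · exact ⟨a, ha, -b, by rw [h, map_inv₀, inv_pow, hab, zpow_neg]⟩
  choose a ha b hab using hVu
  have hdvd : ∀ j, ∃ c, ∏ j, a j = a j * c := fun j => Finset.dvd_prod_of_mem a (Finset.mem_univ j)
  choose c hc using hdvd
  have hA : 0 < ∏ j, a j := Finset.prod_pos fun j _ => ha j
  have hZ0 : 0 < V.valuation (w i) := zero_lt_iff.2 (by simpa using hw0 i)
  -- `b j * c j` is the exponent of `u j` with respect to `w i`, up to the common factor `∏ a`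
  have hmain : ∀ n : Fin d → ℤ, V.valuation (∏ j, u j ^ n j) ^ (∏ j, a j) =
      V.valuation (w i) ^ (n ⬝ᵥ fun j => b j * c j) := by
    intro n
    have h1 : ∀ s : Finset (Fin d), V.valuation (∏ j ∈ s, u j ^ n j) ^ (∏ j, a j) =
        V.valuation (w i) ^ (∑ j ∈ s, n j * (b j * c j)) := by
      intro s
      induction s using Finset.induction_on with
      | empty => simp
      | insert j s hj ih =>
        rw [Finset.prod_insert hj, Finset.sum_insert hj, map_mul, mul_pow, ih, zpow_add₀ hZ0.ne',
          map_zpow₀]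
        congr 1
        rw [hc j, ← zpow_natCast, ← zpow_mul, Nat.cast_mul,
          show n j * ((a j : ℤ) * c j) = a j * (c j * n j) by ring, zpow_mul, zpow_natCast, hab,
          ← zpow_mul]
        congr 1
        ring
    exact h1 Finset.univ
  have hone : ∀ n : Fin d → ℤ, (n ⬝ᵥ fun j => b j * (c j : ℤ)) = 0 →
      V.valuation (∏ j, u j ^ n j) = 1 := by
    intro n hn
    have := hmain n
    rw [hn, zpow_zero] at this
    exact (pow_eq_one_iff.1 this).resolve_right hA.ne'
  refine ⟨V, fun j => b j * c j, ?_, fun n => ⟨hone n, fun hn => ?_⟩⟩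
  · intro h0
    have := hone (Pi.single i 1) (by rw [h0]; simp)
    rw [Finset.prod_eq_single i (by intro j _ hj; simp [hj]) (by simp)] at this
    simp only [Pi.single_eq_same, zpow_one] at this
    rcases hwu i with h | h <;> rw [h] at this
    · exact hVz.ne this
    · rw [map_inv₀, inv_eq_one] at this
      exact hVz.ne this
  · by_contra! hge
    have h1 := one_le_pow_of_one_le' hge (∏ j, a j)
    rw [hmain n] at h1
    obtain ⟨m, hm⟩ := Int.eq_ofNat_of_zero_le hn.le
    rw [hm] at h1 hn
    have h2 : V.valuation (w i) ^ m < 1 := pow_lt_one₀ zero_le hVz (by omega)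
    rw [zpow_natCast] at h1
    exact absurd h1 (not_le.2 h2)

/-! ### Subgroups of `M` with exhausting translates -/

/-- Over a Noetherian ring, `m ∉ S t m` suffices for `m` to avoid a submodule whose quotient is
`t`-power torsion. The submodule is chosen maximal among those that contain `t • m` but not `m`. -/
theorem exists_submodule_not_mem_torsion_quotient {S M : Type*} [CommRing S] [IsNoetherianRing S]
    [AddCommGroup M] [Module S M] {t : S} {m : M} (h : m ∉ Submodule.span S {t • m}) :
    ∃ N : Submodule S M, m ∉ N ∧ ∀ b, ∃ k : ℕ, t ^ k • b ∈ N := by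
  obtain ⟨N, -, ⟨htN, hmN⟩, hmax⟩ := zorn_le_nonempty₀ {N : Submodule S M | t • m ∈ N ∧ m ∉ N}
    (by
      intro c hc hchain N₀ hN₀
      refine ⟨sSup c, ⟨le_sSup hN₀ (hc hN₀).1, fun hm => ?_⟩, fun N hN => le_sSup hN⟩
      obtain ⟨N, hN, hmN⟩ := (Submodule.mem_sSup_of_directed ⟨N₀, hN₀⟩ hchain.directedOn).1 hm
      exact (hc hN).2 hmN)
    (Submodule.span S {t • m}) ⟨Submodule.mem_span_singleton_self _, h⟩
  refine ⟨N, hmN, fun b => ?_⟩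
  -- the ideals `{s | s • t ^ k • b ∈ N}` stabilize at some `k`, and then `t ^ k • b ∈ N`
  let I : ℕ →o Ideal S :=
    { toFun := fun k => N.comap (LinearMap.toSpanSingleton S M (t ^ k • b))
      monotone' := monotone_nat_of_le_succ fun k s hs => by
        rw [Submodule.mem_comap, LinearMap.toSpanSingleton_apply] at hs ⊢
        rw [pow_succ', mul_smul, smul_comm]
        exact N.smul_mem t hs }
  obtain ⟨k, hk⟩ := monotone_stabilizes_iff_noetherian.2 ‹IsNoetherianRing S› I
  refine ⟨k, by_contra fun hb => ?_⟩
  have hmem : m ∈ N ⊔ Submodule.span S {t ^ k • b} := by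
    by_contra hm
    have hle := hmax ⟨Submodule.mem_sup_left htN, hm⟩ le_sup_left
    exact hb (hle (Submodule.mem_sup_right (Submodule.mem_span_singleton_self _)))
  obtain ⟨n, hn, y, hy, hny⟩ := Submodule.mem_sup.1 hmem
  obtain ⟨s, rfl⟩ := Submodule.mem_span_singleton.1 hy
  -- multiplying `m = n + s • t ^ k • b` by `t` gives `s • t ^ (k + 1) • b ∈ N`
  have hs : s ∈ I (k + 1) := by
    change s • t ^ (k + 1) • b ∈ N
    have h1 : t • (s • t ^ k • b) = t • m - t • n := by rw [← hny, smul_add, add_sub_cancel_left]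
    rw [pow_succ', mul_smul, smul_comm, h1]
    exact N.sub_mem htN (N.smul_mem t hn)
  rw [← hk (k + 1) k.le_succ] at hs
  exact hmN (hny ▸ N.add_mem hn hs)

/-- The subring of `ℤ[u₁^{±1}, …, u_d^{±1}]` generated by `u^v` and by the monomials `u^n` whose
exponent is orthogonal to `v`. -/
noncomputable def halfSpaceSubalgebra {d : ℕ} (v : Fin d → ℤ) : Subalgebra ℤ (LaurentRing d) :=
  Algebra.adjoin ℤ (monom '' {n | n ⬝ᵥ v = 0} ∪ {monom v})

theorem monom_mem_halfSpaceSubalgebra {d : ℕ} {v n : Fin d → ℤ} (h : n ⬝ᵥ v = 0) :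
    monom n ∈ halfSpaceSubalgebra v :=
  Algebra.subset_adjoin (Or.inl ⟨n, h, rfl⟩)

theorem monom_self_mem_halfSpaceSubalgebra {d : ℕ} (v : Fin d → ℤ) :
    monom v ∈ halfSpaceSubalgebra v :=
  Algebra.subset_adjoin (Or.inr rfl)

/-- The subring is a finitely generated `ℤ`-algebra, since the orthogonal complement of `v` in
`ℤ^d` is a finitely generated group. -/
theorem isNoetherianRing_halfSpaceSubalgebra {d : ℕ} (v : Fin d → ℤ) :
    IsNoetherianRing (halfSpaceSubalgebra v) := by
  let L : AddSubgroup (Fin d → ℤ) :=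
    { carrier := {n | n ⬝ᵥ v = 0}
      zero_mem' := zero_dotProduct v
      add_mem' := fun {a b} ha hb => by
        rw [Set.mem_ofPred_eq] at *
        rw [add_dotProduct, ha, hb, add_zero]
      neg_mem' := fun {a} ha => by
        rw [Set.mem_ofPred_eq] at *
        rw [neg_dotProduct, ha, neg_zero] }
  obtain ⟨s, hs⟩ : L.FG :=
    (Submodule.fg_iff_addSubgroup_fg (AddSubgroup.toIntSubmodule L)).1 (IsNoetherian.noetherian _)
  have hL : AddSubmonoid.closure ((s : Set (Fin d → ℤ)) ∪ -s) = L.toAddSubmonoid := by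
    rw [← AddSubgroup.closure_toAddSubmonoid, hs]
  have hmem : ∀ n, n ∈ L ↔ n ∈ AddSubmonoid.closure ((s : Set (Fin d → ℤ)) ∪ -s) := by
    intro n; rw [hL]; rfl
  have hfin : (monom '' ((s : Set (Fin d → ℤ)) ∪ -s) ∪ {monom v}).Finite :=
    ((s.finite_toSet.union s.finite_toSet.neg).image _).union (Set.finite_singleton _)
  have heq : Algebra.adjoin ℤ (monom '' ((s : Set (Fin d → ℤ)) ∪ -s) ∪ {monom v}) =
      halfSpaceSubalgebra v := by
    refine le_antisymm (Algebra.adjoin_mono (Set.union_subset_union_left _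
      (Set.image_mono fun n hn => (hmem n).2 (AddSubmonoid.subset_closure hn))))
      (Algebra.adjoin_le ?_)
    rintro _ (⟨n, hn, rfl⟩ | h)
    · have hn' := (hmem n).1 hn
      induction hn' using AddSubmonoid.closure_induction with
      | mem n h => exact Algebra.subset_adjoin (Or.inl ⟨n, h, rfl⟩)
      | zero => exact monom_zero (d := d) ▸ one_mem _
      | add a b ha hb iha ihb =>
        rw [monom_add]
        exact mul_mem (iha ((hmem a).2 ha)) (ihb ((hmem b).2 hb))
    · exact Algebra.subset_adjoin (Or.inr h)
  exact Algebra.FiniteType.isNoetherianRing ℤ (h := (Subalgebra.fg_iff_finiteType _).1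
    (Subalgebra.fg_def.2 ⟨_, hfin, heq⟩))

/-- The field is the fraction field of `A ⧸ P`, where `P` is a prime ideal disjoint from the set
of values at `y` of monic integral polynomials. -/
theorem exists_ringHom_field_not_isIntegral.{w} {A : Type w} [CommRing A] {y : A}
    (hy : ¬ IsIntegral ℤ y) :
    ∃ (K : Type w) (_ : Field K) (φ : A →+* K), ¬ IsIntegral ℤ (φ y) := by
  let T : Submonoid A :=
    { carrier := {a | ∃ p : Polynomial ℤ, p.Monic ∧ Polynomial.aeval y p = a}
      one_mem' := ⟨1, Polynomial.monic_one, map_one _⟩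
      mul_mem' := by
        rintro _ _ ⟨p, hp, rfl⟩ ⟨q, hq, rfl⟩
        exact ⟨p * q, hp.mul hq, map_mul _ _ _⟩ }
  have hT : Disjoint ((⊥ : Ideal A) : Set A) (T : Set A) := by
    rw [Set.disjoint_left]
    rintro a ha ⟨p, hp, hpa⟩
    exact hy ⟨p, hp, hpa.trans ha⟩
  obtain ⟨P, hP, -, hPT⟩ := Ideal.exists_le_prime_disjoint ⊥ T hT
  refine ⟨FractionRing (A ⧸ P), inferInstance,
    (algebraMap (A ⧸ P) (FractionRing (A ⧸ P))).comp (Ideal.Quotient.mk P), ?_⟩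
  rintro ⟨p, hp, h⟩
  have hmem : Polynomial.aeval y p ∈ T := ⟨p, hp, rfl⟩
  refine Set.disjoint_right.1 hPT hmem ?_
  rw [SetLike.mem_coe, ← Ideal.Quotient.eq_zero_iff_mem]
  apply IsFractionRing.injective (A ⧸ P) (FractionRing (A ⧸ P))
  rw [map_zero, ← h, Polynomial.aeval_def, Polynomial.hom_eval₂, Polynomial.hom_eval₂]
  congr 1
  exact RingHom.ext_int _ _

theorem isIntegral_monom_of_generators {d : ℕ} {A : Type*} [CommRing A] (φ : LaurentRing d →+* A)
    (h : ∀ i, IsIntegral ℤ (φ (monom (Pi.single i 1))) ∧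
      IsIntegral ℤ (φ (monom (Pi.single i (-1))))) (n : Fin d → ℤ) :
    IsIntegral ℤ (φ (monom n)) := by
  let T : AddSubmonoid (Fin d → ℤ) :=
    { carrier := {n | IsIntegral ℤ (φ (monom n))}
      zero_mem' := by
        change IsIntegral ℤ (φ (monom 0))
        rw [monom_zero, map_one]
        exact isIntegral_one
      add_mem' := fun {a b} ha hb => by
        change IsIntegral ℤ (φ (monom (a + b)))
        rw [monom_add, map_mul]
        exact IsIntegral.mul ha hb }
  change n ∈ T
  rw [← Finset.univ_sum_single n]
  refine T.sum_mem fun j _ => ?_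
  obtain ⟨k, hk | hk⟩ := Int.eq_nat_or_neg (n j)
  · have : (Pi.single j (n j) : Fin d → ℤ) = k • Pi.single j 1 := by
      rw [← Pi.single_smul, hk]; simp
    rw [this]
    exact T.nsmul_mem (h j).1 k
  · have : (Pi.single j (n j) : Fin d → ℤ) = k • Pi.single j (-1) := by
      rw [← Pi.single_smul, hk]; simp
    rw [this]
    exact T.nsmul_mem (h j).2 k

theorem isIntegral_of_generators {d : ℕ} {A : Type*} [CommRing A] (φ : LaurentRing d →+* A)
    (h : ∀ i, IsIntegral ℤ (φ (monom (Pi.single i 1))) ∧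
      IsIntegral ℤ (φ (monom (Pi.single i (-1))))) (r : LaurentRing d) :
    IsIntegral ℤ (φ r) := by
  induction r using AddMonoidAlgebra.induction_on with
  | of n => exact isIntegral_monom_of_generators φ h n
  | add f g hf hg => rw [map_add]; exact hf.add hg
  | smul c f hf => rw [map_zsmul]; exact hf.smul c

theorem map_monom_eq_prod {d : ℕ} {K : Type*} [Field K] (φ : LaurentRing d →+* K)
    (n : Fin d → ℤ) : φ (monom n) = ∏ j, φ (monom (Pi.single j 1)) ^ n j := by
  let ψ : Multiplicative (Fin d → ℤ) →* Kˣ := MonoidHom.toHomUnits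
    { toFun := fun n => φ (monom n.toAdd)
      map_one' := by rw [toAdd_one, monom_zero, map_one]
      map_mul' := fun a b => by rw [toAdd_mul, monom_add, map_mul] }
  have hψ : ∀ n, φ (monom n) = ψ (Multiplicative.ofAdd n) := fun n => rfl
  have h : Multiplicative.ofAdd n =
      ∏ j, Multiplicative.ofAdd (Pi.single j 1 : Fin d → ℤ) ^ n j := by
    apply Multiplicative.toAdd.injective
    rw [toAdd_prod]
    simp only [toAdd_zpow, toAdd_ofAdd]
    conv_lhs => rw [← Finset.univ_sum_single n]
    refine Finset.sum_congr rfl fun j _ => ?_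
    rw [← Pi.single_smul]; simp
  rw [hψ, h, map_prod, Units.coe_prod]
  refine Finset.prod_congr rfl fun j _ => ?_
  rw [map_zpow, Units.val_zpow_eq_zpow_val, hψ]

/-- If `m ∉ F(M)`, then some `v` satisfies `m ∉ u^v S m`, where `S` is the subring attached to
`v`: the additive group of `R_d m ≅ R_d / I` is not finitely generated, so some `u_i^{±1}` is not
integral modulo `I`. For the valuation and the direction that this provides, elements of `u^v S`
have value less than `1` and so are not congruent to `1` modulo `I`. -/
theorem exists_direction_not_mem_smul {d : ℕ} {M : Type*} [AddCommGroup M]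
    [Module (LaurentRing d) M] {m : M} (hm : m ∉ finPart d M) :
    ∃ v : Fin d → ℤ, ∀ s ∈ halfSpaceSubalgebra v, (s * monom v) • m ≠ m := by
  let I : Ideal (LaurentRing d) := LinearMap.ker (LinearMap.toSpanSingleton (LaurentRing d) M m)
  let A := LaurentRing d ⧸ I
  let π : LaurentRing d →+* A := Ideal.Quotient.mk I
  obtain ⟨i, y, hy, hint⟩ : ∃ i, ∃ y : LaurentRing d,
      (y = monom (Pi.single i 1) ∨ y = monom (Pi.single i (-1))) ∧ ¬ IsIntegral ℤ (π y) := by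
    by_contra! hcon
    refine hm ((span_fg_iff m).2 ?_)
    have hA : Algebra.IsIntegral ℤ A := ⟨fun a => by
      obtain ⟨r, rfl⟩ := Ideal.Quotient.mk_surjective a
      exact isIntegral_of_generators π
        (fun i => ⟨hcon i _ (Or.inl rfl), hcon i _ (Or.inr rfl)⟩) r⟩
    have hft : Algebra.FiniteType ℤ A :=
      Algebra.FiniteType.of_surjective (Ideal.Quotient.mkₐ ℤ I) (Ideal.Quotient.mkₐ_surjective ℤ I)
    have hfin : Module.Finite ℤ A := Algebra.IsIntegral.finite
    let f : A →ₗ[ℤ] M :=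
      (I.liftQ (LinearMap.toSpanSingleton (LaurentRing d) M m) le_rfl).toAddMonoidHom.toIntLinearMap
    have hf : LinearMap.range f = (Submodule.span (LaurentRing d) {m}).restrictScalars ℤ := by
      ext x
      rw [Submodule.restrictScalars_mem, Submodule.mem_span_singleton]
      constructor
      · rintro ⟨a, rfl⟩
        obtain ⟨r, rfl⟩ := Ideal.Quotient.mk_surjective a
        exact ⟨r, rfl⟩
      · rintro ⟨r, rfl⟩
        exact ⟨π r, rfl⟩
    rw [← hf]
    exact Module.Finite.fg_top.map f |> (LinearMap.range_eq_map f ▸ ·)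
  obtain ⟨K, _, ψ, hK⟩ := exists_ringHom_field_not_isIntegral hint
  let φ : LaurentRing d →+* K := ψ.comp π
  have hinv : ∀ n : Fin d → ℤ, φ (monom n) * φ (monom (-n)) = 1 := by
    intro n
    rw [← map_mul, ← monom_add, add_neg_cancel, monom_zero, map_one]
  obtain ⟨V, v, hv0, hV⟩ := exists_integral_direction (fun j => φ (monom (Pi.single j 1)))
    (fun j => left_ne_zero_of_mul_eq_one (hinv _)) (i := i) (y := φ y)
    (by
      rcases hy with rfl | rfl
      · exact Or.inl rfl
      · right
        rw [Pi.single_neg]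
        exact eq_inv_of_mul_eq_one_right (hinv _)) hK
  simp only [← map_monom_eq_prod] at hV
  have hvv : V.valuation (φ (monom v)) < 1 := by
    refine (hV v).2 (lt_of_le_of_ne (Finset.sum_nonneg fun j _ => mul_self_nonneg _) fun h => ?_)
    exact hv0 (dotProduct_self_eq_zero.1 h.symm)
  have hS : ∀ s ∈ halfSpaceSubalgebra v, V.valuation (φ s) ≤ 1 := by
    intro s hs
    induction hs using Algebra.adjoin_induction with
    | mem x hx =>
      rcases hx with ⟨n, hn, rfl⟩ | rfl
      · exact ((hV n).1 hn).le
      · exact hvv.le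
    | algebraMap r =>
      rw [V.valuation_le_one_iff, eq_intCast, map_intCast]
      exact intCast_mem V r
    | add x y _ _ hx hy => rw [map_add]; exact V.valuation.map_add_le hx hy
    | mul x y _ _ hx hy => rw [map_mul, map_mul]; exact mul_le_one' hx hy
  refine ⟨v, fun s hs h => ?_⟩
  have hI : s * monom v - 1 ∈ I := by
    rw [LinearMap.mem_ker, LinearMap.toSpanSingleton_apply, sub_smul, h, one_smul, sub_self]
  have hφ : φ (s * monom v - 1) = 0 := by
    change ψ (Ideal.Quotient.mk I _) = 0
    rw [Ideal.Quotient.eq_zero_iff_mem.2 hI, map_zero]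
  rw [map_sub, map_one, sub_eq_zero, map_mul] at hφ
  have h1 := congrArg V.valuation hφ
  rw [map_mul, map_one] at h1
  exact ((mul_le_of_le_one_left' (hS s hs)).trans_lt hvv).ne h1

/-- The dual form of the existence of shrinking subgroups: each `m ∉ F(M)` is avoided by a
subgroup `N` of `M` that is invariant under `u^v` and under all `u^n` with `n` orthogonal to `v`,
and whose translates `u^{-kv} N` exhaust `M`. -/
theorem exists_expanding_addSubgroup {d : ℕ} {M : Type*} [AddCommGroup M]
    [Module (LaurentRing d) M] {m : M} (hm : m ∉ finPart d M) :
    ∃ (v : Fin d → ℤ) (N : AddSubgroup M), m ∉ N ∧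
      (∀ n : Fin d → ℤ, n ⬝ᵥ v = 0 ∨ n = v → ∀ b ∈ N, monom n • b ∈ N) ∧
      ∀ b, ∃ k : ℕ, monom (k • v) • b ∈ N := by
  obtain ⟨v, hv⟩ := exists_direction_not_mem_smul hm
  have := isNoetherianRing_halfSpaceSubalgebra v
  let t : halfSpaceSubalgebra v := ⟨monom v, monom_self_mem_halfSpaceSubalgebra v⟩
  obtain ⟨N, hmN, hN⟩ := exists_submodule_not_mem_torsion_quotient (t := t) (m := m) (by
    rw [Submodule.mem_span_singleton]
    rintro ⟨s, hs⟩
    refine hv s s.2 ?_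
    rw [mul_smul]
    exact hs)
  refine ⟨v, N.toAddSubgroup, hmN, ?_, fun b => ?_⟩
  · rintro n (hn | rfl) b hb
    · exact N.smul_mem ⟨monom n, monom_mem_halfSpaceSubalgebra hn⟩ hb
    · exact N.smul_mem t hb
  · obtain ⟨k, hk⟩ := hN b
    refine ⟨k, ?_⟩
    have : monom (k • v) = (monom v : LaurentRing d) ^ k := by
      induction k generalizing b with
      | zero => rw [zero_smul, monom_zero, pow_zero]
      | succ k ih =>
        clear hk
        rw [succ_nsmul, monom_add, pow_succ]
        congr 1
        simp [monom, AddMonoidAlgebra.single_pow]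
    rw [this]
    exact hk

/-! ### Shrinking subgroups -/

/-- The annihilator in `X_M` of a subgroup of `M`. -/
def dualAnnihilator {M : Type*} [AddCommGroup M] [TopologicalSpace M] (N : AddSubgroup M) :
    Subgroup (DualGroup M) where
  carrier := {x | ∀ a ∈ N, x (Multiplicative.ofAdd a) = 1}
  one_mem' := fun _ _ => rfl
  mul_mem' := by
    intro x y hx hy a ha
    change x (Multiplicative.ofAdd a) * y (Multiplicative.ofAdd a) = 1
    rw [hx a ha, hy a ha, one_mul]
  inv_mem' := by
    intro x hx a ha
    change (x (Multiplicative.ofAdd a))⁻¹ = 1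
    rw [hx a ha, inv_one]

theorem isClosed_dualAnnihilator {M : Type*} [AddCommGroup M] [TopologicalSpace M]
    [DiscreteTopology M] (N : AddSubgroup M) :
    IsClosed (dualAnnihilator N : Set (DualGroup M)) := by
  have h : (dualAnnihilator N : Set (DualGroup M)) =
      ⋂ a ∈ N, {x | x (Multiplicative.ofAdd a) = 1} := by
    ext x
    simp only [Set.mem_iInter]
    rfl
  rw [h]
  exact isClosed_biInter fun a _ => isClosed_eq (continuous_dual_eval _) continuous_const

theorem isClosed_perp {d : ℕ} {M : Type*} [AddCommGroup M] [Module (LaurentRing d) M]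
    [TopologicalSpace M] [DiscreteTopology M] (N : Submodule (LaurentRing d) M) :
    IsClosed (perp N : Set (DualGroup M)) :=
  isClosed_dualAnnihilator N.toAddSubgroup

theorem mem_imageSubgroup {d : ℕ} {M : Type*} [AddCommGroup M] [Module (LaurentRing d) M]
    [TopologicalSpace M] [DiscreteTopology M] {n : Fin d → ℤ} {H : Subgroup (DualGroup M)}
    {x : DualGroup M} : x ∈ imageSubgroup M n H ↔ ∃ y ∈ H, dualAction M n y = x :=
  Subgroup.mem_map

theorem antitone_imageSubgroup_nsmul {d : ℕ} {M : Type*} [AddCommGroup M]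
    [Module (LaurentRing d) M] [TopologicalSpace M] [DiscreteTopology M] {v : Fin d → ℤ}
    {H : Subgroup (DualGroup M)} (h : imageSubgroup M v H ≤ H) :
    Antitone fun j : ℕ => imageSubgroup M (j • v) H := by
  refine antitone_nat_of_succ_le fun j x hx => ?_
  obtain ⟨y, hy, rfl⟩ := mem_imageSubgroup.1 hx
  refine mem_imageSubgroup.2 ⟨dualAction M v y, h (mem_imageSubgroup.2 ⟨y, hy, rfl⟩), ?_⟩
  rw [succ_nsmul, dualAction_add]

/-- Let `m ∈ F(M)`. By compactness some `α(j v)(H)` with `j ≥ 1` maps the finitely many additive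
generators of `R_d m` into an open half circle. The half circle contains no nontrivial subgroup, so
`α(j v)(H)` is trivial on `R_d m`, and then so is `H` because `R_d m` is invariant under `u^{jv}`. -/
theorem IsShrinking.le_perp_finPart {d : ℕ} {M : Type*} [AddCommGroup M]
    [Module (LaurentRing d) M] [TopologicalSpace M] [DiscreteTopology M]
    {H : Subgroup (DualGroup M)} (hH : IsShrinking d M H) : H ≤ perp (finPart d M) := by
  have : DiscreteTopology (Multiplicative M) := inferInstanceAs (DiscreteTopology M)
  obtain ⟨hclosed, v, hv, hbot, -⟩ := hH
  intro x hx m hm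
  obtain ⟨s, hs⟩ : (Submodule.span (LaurentRing d) {m}).toAddSubgroup.FG := hm
  let U : Set (DualGroup M) :=
    ⋂ a ∈ s, {y | y (Multiplicative.ofAdd a) ∈ Circle.centeredArc (Real.pi / 2)}
  have hU : IsOpen U := isOpen_biInter_finset fun a _ =>
    (Circle.isOpen_centeredArc _).preimage (continuous_dual_eval _)
  have hanti := antitone_imageSubgroup_nsmul hv
  -- the index is shifted because the intersection starts at `j = 1`
  let W : ℕ → Set (DualGroup M) := fun j => imageSubgroup M ((j + 1) • v) H
  have hW : ∀ j, IsCompact (W j) := fun j =>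
    hclosed.isCompact.image (dualAction M ((j + 1) • v)).continuous_toFun
  have hdir : Directed (· ⊇ ·) W := directed_of_isDirected_le fun i j hij =>
    hanti (Nat.succ_le_succ hij)
  obtain ⟨j, hj⟩ := exists_subset_nhds_of_isCompact hdir hW (U := U) (by
    intro y hy
    rw [Set.mem_iInter] at hy
    have hy1 : y ∈ (⨅ (j : ℕ) (_ : 1 ≤ j), imageSubgroup M (j • v) H) := by
      simp only [Subgroup.mem_iInf]
      intro j hj
      obtain ⟨j, rfl⟩ := Nat.exists_eq_add_of_le' hj
      exact hy j
    rw [hbot, Subgroup.mem_bot] at hy1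
    refine hU.mem_nhds ?_
    simp only [U, Set.mem_iInter, hy1]
    intro a _
    change (1 : Circle) ∈ Circle.centeredArc (Real.pi / 2)
    rw [Circle.mem_centeredArc (by linarith [Real.pi_pos])]
    simp [Real.pi_pos])
  -- the subgroup `α((j + 1) v)(H)` takes the generators of `R_d m` into a half circle
  let y := dualAction M ((j + 1) • v) x
  have hy : y ∈ imageSubgroup M ((j + 1) • v) H := mem_imageSubgroup.2 ⟨x, hx, rfl⟩
  have hys : ∀ a ∈ s, y (Multiplicative.ofAdd a) = 1 := by
    intro a ha
    refine Circle.eq_one_of_forall_pow_mem_centeredArc_pi_div_two fun n _ => ?_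
    have hyn : y ^ n ∈ U := hj ((imageSubgroup M ((j + 1) • v) H).pow_mem hy n)
    let ev : DualGroup M →* Circle :=
      { toFun := fun z => z (Multiplicative.ofAdd a)
        map_one' := rfl
        map_mul' := fun _ _ => rfl }
    have hev : ev (y ^ n) ∈ Circle.centeredArc (Real.pi / 2) := Set.mem_iInter₂.1 hyn a ha
    rwa [map_pow] at hev
  have hspan : ∀ b ∈ (Submodule.span (LaurentRing d) {m}).toAddSubgroup,
      y (Multiplicative.ofAdd b) = 1 := by
    intro b hb
    rw [← hs] at hb
    induction hb using AddSubgroup.closure_induction with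
    | mem a ha => exact hys a ha
    | zero => exact map_one y
    | add a b _ _ ha hb => rw [ofAdd_add, map_mul, ha, hb, one_mul]
    | neg a _ ha => rw [ofAdd_neg, map_inv, ha, inv_one]
  have h1 := hspan (monom (-((j + 1) • v)) • m)
    (Submodule.smul_mem _ _ (Submodule.mem_span_singleton_self m))
  rw [dualAction_apply, smul_smul, ← monom_add, add_neg_cancel, monom_zero, one_smul] at h1
  exact h1

theorem isShrinking_dualAnnihilator {d : ℕ} {M : Type*} [AddCommGroup M]
    [Module (LaurentRing d) M] [TopologicalSpace M] [DiscreteTopology M] {v : Fin d → ℤ}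
    {N : AddSubgroup M}
    (hN : ∀ n : Fin d → ℤ, n ⬝ᵥ v = 0 ∨ n = v → ∀ b ∈ N, monom n • b ∈ N)
    (hexp : ∀ b, ∃ k : ℕ, monom (k • v) • b ∈ N) :
    IsShrinking d M (dualAnnihilator N) := by
  have himage : ∀ n : Fin d → ℤ, n ⬝ᵥ v = 0 ∨ n = v →
      imageSubgroup M n (dualAnnihilator N) ≤ dualAnnihilator N := by
    intro n hn x hx b hb
    obtain ⟨y, hy, rfl⟩ := mem_imageSubgroup.1 hx
    rw [dualAction_apply]
    exact hy _ (hN n hn b hb)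
  refine ⟨isClosed_dualAnnihilator N, v, himage v (Or.inr rfl), ?_, fun n hn => ?_⟩
  · rw [eq_bot_iff]
    intro x hx
    simp only [Subgroup.mem_iInf] at hx
    rw [Subgroup.mem_bot]
    refine PontryaginDual.ext fun b => ?_
    obtain ⟨k, hk⟩ := hexp b.toAdd
    obtain ⟨y, hy, rfl⟩ := mem_imageSubgroup.1 (hx (k + 1) (Nat.le_add_left 1 k))
    change y (Multiplicative.ofAdd (monom ((k + 1) • v) • b.toAdd)) = 1
    rw [succ_nsmul', monom_add, mul_smul]
    exact hy _ (hN v (Or.inr rfl) _ hk)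
  · refine le_antisymm (himage n (Or.inl hn)) fun x hx => ?_
    refine mem_imageSubgroup.2 ⟨dualAction M (-n) x, ?_, ?_⟩
    · exact himage (-n) (Or.inl (by rw [neg_dotProduct, hn, neg_zero]))
        (mem_imageSubgroup.2 ⟨x, hx, rfl⟩)
    · rw [← dualAction_add, add_neg_cancel, dualAction_zero]

theorem mainTheorem4 (d : ℕ) (hd : 1 ≤ d) (M : Type*) [AddCommGroup M]
    [Module (LaurentRing d) M] [Countable M] [TopologicalSpace M] [DiscreteTopology M] :
    shrinkingHull d M = perp (finPart d M) := by
  refine le_antisymm ((shrinkingHull_isLeast d M).2 ⟨isClosed_perp _, fun H hH =>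
    hH.le_perp_finPart⟩) fun x hx => ?_
  obtain ⟨hclosed, hK⟩ := (shrinkingHull_isLeast d M).1
  by_contra hxK
  obtain ⟨a, ha, hxa⟩ := exists_character_separating_closed_subgroup hclosed hxK
  have haF : a ∉ finPart d M := fun h => hxa (hx a h)
  obtain ⟨v, N, haN, hN, hexp⟩ := exists_expanding_addSubgroup haF
  obtain ⟨y, hyN, hya⟩ := exists_dual_eq_one_on_apply_ne_one haN
  exact hya (ha y (hK _ (isShrinking_dualAnnihilator hN hexp) hyN))
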